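/- Let $x=(x_1,x_2)$ be two variables and work in $\mathbb Q[x_1,x_2]$. Let $\mathscr P^{(2)}$ be the set of partitions $\lambda=(\lambda_1,\lambda_2)$, $\lambda_1\ge\lambda_2\ge0$, of length at most $2$, and put $\Delta=(2,1)$, $\delta=(1,0)$; addition and doubling of partitions are componentwise. For $\lambda\in\mathscr P^{(2)}$ let $$s_\lambda(x)=\frac{a_{\lambda+\delta}(x)}{a_\delta(x)},\qquad a_\alpha(x)=\sum_{\sigma\in\mathfrak S_2}\mathrm{sgn}(\sigma)\,x_{\sigma(1)}^{\alpha_1}x_{\sigma(2)}^{\alpha_2},$$ be the Schur polynomial, and define the Littlewood–Richardson coefficients by $s_\mu(x)s_\nu(x)=\sum_{\lambda\in\mathscr P^{(2)}}c^\lambda_{\mu\nu}s_\lambda(x)$. Define $q_r(x)$ and $q_r(x,x)$ for $r\ge0$ by $$\sum_{r\ge0}q_r(x)t^r=\prod_{i=1}^2\frac{1+x_it}{1-x_it},\qquad \sum_{r\ge0}q_r(x,x)t^r=\prod_{i=1}^2\left(\frac{1+x_it}{1-x_it}\right)^2,$$ and put $q_r(x)=q_r(x,x)=0$ for $r<0$.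 For $\lambda\in\mathscr P^{(2)}$ the $2$-reduced Schur polynomial is $S_\lambda(x)=\det\bigl(q_{\lambda_i-i+j}(x)\bigr)_{1\le i,j\le2}$. For $r\ge s\ge0$, $(r,s)\neq(0,0)$, Schur's $Q$-polynomial in the doubled variables $(x,x)=(x_1,x_2,x_1,x_2)$ is $$Q_{(r,s)}(x,x)=q_r(x,x)q_s(x,x)+2\sum_{i=1}^s(-1)^iq_{r+i}(x,x)q_{s-i}(x,x).$$ Theorem. Let $\lambda\in\mathscr P^{(2)}$. Then $c^\lambda_{\mu\nu}\neq0$ for only finitely many pairs $(\mu,\nu)\in\mathscr P^{(2)}\times\mathscr P^{(2)}$, and $$\sum_{\mu,\nu\in\mathscr P^{(2)}}c^\lambda_{\mu\nu}\,S_{2\mu+\Delta}(x)\,S_{2\nu+\Delta}(x)=2^{-2}\,Q_{2\lambda+2\Delta}(x,x),$$ $$\sum_{\mu,\nu\in\mathscr P^{(2)}}c^\lambda_{\mu\nu}\,S_{2\mu+\delta}(x)\,S_{2\nu+\Delta}(x)=2^{-2}\,Q_{2\lambda+\Delta+\delta}(x,x).$$ -/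

import Mathlib

namespace SchurQ

open MvPolynomial

/-- Partitions of length at most `n`, written as weakly decreasing sequences of exactly `n`
non-negative integers (padded by zeros on the right). -/
abbrev Part (n : ℕ) : Type := {l : Fin n → ℕ // Antitone l}

/-- The staircase `(n-1, n-2, …, 1, 0)`. -/
def stair (n : ℕ) : Fin n → ℕ := fun i => n - 1 - (i : ℕ)

/-- The antisymmetric polynomial `∑ σ, sgn(σ) σ(x^α)`, where
`σ(x^α) = x_{σ(1)}^{α_1} ⋯ x_{σ(n)}^{α_n}`. -/
noncomputable def alternant {n : ℕ} (α : Fin n → ℕ) : MvPolynomial (Fin n) ℚ :=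
  ∑ σ : Equiv.Perm (Fin n), Equiv.Perm.sign σ • ∏ i, X (σ i) ^ α i

theorem alternant_eq_det {n : ℕ} (α : Fin n → ℕ) :
    alternant α
      = (Matrix.of fun i j => (X i : MvPolynomial (Fin n) ℚ) ^ α j).det := by
  simp [alternant, Matrix.det_apply]

theorem rename_alternant {n : ℕ} (τ : Equiv.Perm (Fin n)) (α : Fin n → ℕ) :
    rename τ (alternant α) = Equiv.Perm.sign τ • alternant α := by
  unfold alternant
  rw [Finset.smul_sum, map_sum]
  refine Fintype.sum_equiv (Equiv.mulLeft τ) _ _ fun σ => ?_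
  simp only [Units.smul_def, map_zsmul, map_prod, map_pow, rename_X, Equiv.coe_mulLeft,
    Equiv.Perm.sign_mul, Equiv.Perm.coe_mul, Function.comp, smul_smul, ← Units.val_mul]
  rw [← mul_assoc, Int.units_mul_self, one_mul]

theorem alternant_comp {n : ℕ} (τ : Equiv.Perm (Fin n)) (α : Fin n → ℕ) :
    alternant (α ∘ τ) = Equiv.Perm.sign τ • alternant α := by
  unfold alternant
  rw [Finset.smul_sum]
  refine Fintype.sum_equiv (Equiv.mulRight τ⁻¹) _ _ fun σ => ?_
  simp only [Equiv.coe_mulRight, Equiv.Perm.sign_mul, Equiv.Perm.coe_mul, Function.comp,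
    smul_smul, Equiv.Perm.sign_inv]
  rw [mul_left_comm, Int.units_mul_self, mul_one]
  congr 1
  refine Fintype.prod_equiv τ _ _ fun i => ?_
  simp

theorem coeff_alternant {n : ℕ} {α β : Fin n → ℕ} (hα : StrictAnti α) (hβ : StrictAnti β) :
    coeff (Finsupp.equivFunOnFinite.symm β) (alternant α) = if α = β then 1 else 0 := by
  have key : ∀ σ : Equiv.Perm (Fin n), (∏ i, (X (σ i) : MvPolynomial (Fin n) ℚ) ^ α i)
      = monomial (Finsupp.equivFunOnFinite.symm (α ∘ σ.symm)) 1 := by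
    intro σ
    rw [monomial_eq, Finsupp.prod_fintype _ _ (by simp)]
    rw [C_1, one_mul]
    refine Fintype.prod_equiv σ _ _ fun i => ?_
    simp
  have huniq : ∀ σ : Equiv.Perm (Fin n), α ∘ σ.symm = β → σ = 1 := by
    intro σ h
    have hm : StrictMono σ.symm := by
      intro i j hij
      have h1 := hβ hij
      rw [← h] at h1
      exact hα.lt_iff_gt.1 h1
    have hid : ∀ i, σ.symm i = i := by
      have := Subsingleton.elim (hm.orderIsoOfSurjective _ σ.symm.surjective) (OrderIso.refl _)
      intro i
      exact congrArg (fun e : Fin n ≃o Fin n => e i) this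
    ext i
    have := hid (σ i)
    simp at this
    simp [← this]
  unfold alternant
  simp only [key, Units.smul_def, coeff_sum]
  rw [Finset.sum_eq_single 1]
  · simp only [Equiv.Perm.sign_one, Units.val_one, one_smul, coeff_monomial,
      EmbeddingLike.apply_eq_iff_eq]
    rfl
  · intro σ _ hσ
    rw [coeff_smul, coeff_monomial, if_neg, smul_zero]
    intro h
    exact hσ (huniq σ (Finsupp.equivFunOnFinite.symm.injective h))
  · simp

theorem strictAnti_add_stair {n : ℕ} (l : Part n) : StrictAnti (l.1 + stair n) := by
  intro i j hij
  have h1 := l.2 hij.le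
  have h2 : (i : ℕ) < j := hij
  have := j.2
  simp only [Pi.add_apply, stair]
  omega

theorem strictAnti_stair (n : ℕ) : StrictAnti (stair n) := by
  intro i j hij
  have h2 : (i : ℕ) < j := hij
  have := j.2
  simp only [stair]
  omega

theorem alternant_stair_ne_zero (n : ℕ) : alternant (stair n) ≠ 0 := by
  intro h
  have := coeff_alternant (strictAnti_stair n) (strictAnti_stair n)
  simp [h] at this

theorem alternant_stair_dvd_of_antisymm {n : ℕ} {f : MvPolynomial (Fin n) ℚ}
    (hf : ∀ τ : Equiv.Perm (Fin n), rename τ f = Equiv.Perm.sign τ • f) :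
    alternant (stair n) ∣ f := by
  have h0 : alternant (stair n) ∣ alternant (fun i : Fin n => (i : ℕ)) := by
    have : (fun i : Fin n => (i : ℕ)) ∘ Fin.revPerm = stair n := by
      funext i
      simp only [Function.comp, Fin.revPerm_apply, Fin.val_rev, stair]
      omega
    rw [← this, alternant_comp, Units.smul_def, zsmul_eq_mul]
    refine ⟨((Equiv.Perm.sign (Fin.revPerm : Equiv.Perm (Fin n)) : ℤ) :
      MvPolynomial (Fin n) ℚ), ?_⟩
    rw [mul_right_comm, ← Int.cast_mul, ← Units.val_mul, Int.units_mul_self]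
    simp
  refine h0.trans ?_
  have hV : alternant (fun i : Fin n => (i : ℕ))
      = ∏ p : (Σ i : Fin n, {j : Fin n // i < j}), (X p.2.1 - X p.1) := by
    rw [alternant_eq_det]
    change (Matrix.vandermonde (fun i => (X i : MvPolynomial (Fin n) ℚ))).det = _
    rw [Matrix.det_vandermonde, Fintype.prod_sigma]
    refine Finset.prod_congr rfl fun i _ => ?_
    refine Finset.prod_subtype _ (fun j => ?_) _
    simp
  rw [hV]
  have hdvd : ∀ (i j : Fin n) (g : MvPolynomial (Fin n) ℚ),
      (X j - X i : MvPolynomial (Fin n) ℚ) ∣ g - aeval (Function.update X j (X i)) g := by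
    intro i j g
    rw [← Ideal.mem_span_singleton, ← Ideal.Quotient.mk_eq_mk_iff_sub_mem]
    set I : Ideal (MvPolynomial (Fin n) ℚ) := Ideal.span {X j - X i}
    have : (Ideal.Quotient.mkₐ ℚ I) = (Ideal.Quotient.mkₐ ℚ I).comp
        (aeval (Function.update X j (X i))) := by
      apply algHom_ext
      intro k
      by_cases hk : k = j
      · subst hk
        simp only [AlgHom.comp_apply, aeval_X, Function.update_self]
        exact (Ideal.Quotient.mk_eq_mk_iff_sub_mem _ _).2
          (Ideal.mem_span_singleton.2 dvd_rfl)
      · simp [Function.update_of_ne hk]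
    exact congrArg (fun φ => φ g) this
  apply Fintype.prod_dvd_of_isRelPrime
  · rintro ⟨i, j, hij⟩ ⟨k, l, hkl⟩ hne
    have hirr : Irreducible (X j - X i : MvPolynomial (Fin n) ℚ) := by
      have h1 : sumSMulX (Finsupp.single j (1 : ℚ) - Finsupp.single i 1)
          = (X j - X i : MvPolynomial (Fin n) ℚ) := by
        rw [map_sub]
        simp [sumSMulX]
      have h2 : (Finsupp.single j (1 : ℚ) - Finsupp.single i 1 : Fin n →₀ ℚ) j = 1 := by
        simp [hij.ne]
      rw [← h1]
      refine irreducible_sumSMulX _ ⟨j, ?_⟩ fun r hr => ?_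
      · rw [Finsupp.mem_support_iff, h2]
        exact one_ne_zero
      · exact isUnit_of_dvd_one (h2 ▸ hr j)
    change IsRelPrime (X j - X i : MvPolynomial (Fin n) ℚ) (X l - X k)
    rw [hirr.isRelPrime_iff_not_dvd]
    rintro ⟨q, hq⟩
    have hq' := fun p : Fin n → ℚ => congrArg (eval p) hq
    simp only [map_mul, map_sub, eval_X] at hq'
    by_cases hk : k = i ∨ k = j
    · have hl : l ≠ i ∧ l ≠ j := by
        constructor
        · rintro rfl
          rcases hk with rfl | rfl
          · exact lt_irrefl _ hkl
          · exact lt_asymm hij hkl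
        · rintro rfl
          rcases hk with rfl | rfl
          · exact hne rfl
          · exact lt_irrefl _ hkl
      have := hq' (Pi.single l 1)
      simp [hl.1.symm, hl.2.symm, hkl.ne] at this
    · push Not at hk
      have := hq' (Pi.single k 1)
      simp [hk.1.symm, hk.2.symm, hkl.ne'] at this
  · rintro ⟨i, j, hij⟩
    have h1 := hdvd i j f
    have h2 : aeval (Function.update X j (X i)) f = (0 : MvPolynomial (Fin n) ℚ) := by
      have h3 := congrArg (aeval (Function.update X j (X i) : Fin n → MvPolynomial (Fin n) ℚ))
        (hf (Equiv.swap i j))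
      rw [aeval_rename, Equiv.Perm.sign_swap hij.ne] at h3
      have h4 : (Function.update X j (X i) : Fin n → MvPolynomial (Fin n) ℚ) ∘ (Equiv.swap i j)
          = Function.update X j (X i) := by
        funext k
        by_cases hki : k = i
        · subst hki
          simp [Function.update_of_ne hij.ne]
        · by_cases hkj : k = j
          · subst hkj
            simp [Function.update_of_ne hij.ne]
          · simp [Equiv.swap_apply_of_ne_of_ne hki hkj]
      rw [h4] at h3
      simp only [Units.smul_def, Units.val_neg, Units.val_one, neg_smul, one_smul, map_neg] at h3
      exact self_eq_neg.1 h3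
    rwa [h2, sub_zero] at h1

theorem alternant_stair_dvd {n : ℕ} (α : Fin n → ℕ) : alternant (stair n) ∣ alternant α :=
  alternant_stair_dvd_of_antisymm fun τ => rename_alternant τ α

/-- The Schur polynomial `s_λ = a_{λ+δ} / a_δ` in `n` variables, for a partition `λ` of length at
most `n`. The quotient is unique, see `alternant_stair_mul_schur`. -/
noncomputable def schur {n : ℕ} (l : Part n) : MvPolynomial (Fin n) ℚ :=
  (alternant_stair_dvd (l.1 + stair n)).choose

theorem alternant_stair_mul_schur {n : ℕ} (l : Part n) :
    alternant (stair n) * schur l = alternant (l.1 + stair n) :=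
  (alternant_stair_dvd (l.1 + stair n)).choose_spec.symm

theorem schur_isSymmetric {n : ℕ} (l : Part n) : (schur l).IsSymmetric := by
  intro τ
  have h := congrArg (rename τ) (alternant_stair_mul_schur l)
  rw [map_mul, rename_alternant, rename_alternant, smul_mul_assoc] at h
  have h' := smul_left_cancel _ h
  rw [← alternant_stair_mul_schur l] at h'
  exact mul_left_cancel₀ (alternant_stair_ne_zero n) h'

theorem schur_linearIndependent (n : ℕ) :
    LinearIndependent ℚ (schur : Part n → MvPolynomial (Fin n) ℚ) := by
  rw [linearIndependent_iff']
  intro s g hg l hl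
  have h0 : ∑ m ∈ s, g m • alternant (m.1 + stair n) = 0 := by
    rw [← mul_zero (alternant (stair n)), ← hg, Finset.mul_sum]
    refine Finset.sum_congr rfl fun m _ => ?_
    rw [mul_smul_comm, alternant_stair_mul_schur]
  have h1 := congrArg (coeff (Finsupp.equivFunOnFinite.symm (l.1 + stair n))) h0
  simp only [coeff_sum, coeff_smul, coeff_zero,
    coeff_alternant (strictAnti_add_stair _) (strictAnti_add_stair _), add_left_inj] at h1
  rw [Finset.sum_eq_single l] at h1
  · simpa using h1
  · intro m _ hm
    rw [if_neg (fun h => hm (Subtype.ext h)), smul_zero]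
  · exact fun h => absurd hl h

theorem exists_part_of_strictAnti {n : ℕ} {α : Fin n → ℕ} (hα : StrictAnti α) :
    ∃ l : Part n, l.1 + stair n = α := by
  have key : ∀ (d : ℕ) (i j : Fin n), (i : ℕ) + d = j → α j + d ≤ α i := by
    intro d
    induction d with
    | zero => intro i j h; rw [Fin.ext (show (i : ℕ) = j by omega)]; omega
    | succ d ih =>
      intro i j h
      have hlt : (i : ℕ) + d < n := by have := j.2; omega
      have h1 := ih i ⟨i + d, hlt⟩ rfl
      have h2 : α j < α ⟨i + d, hlt⟩ := hα (show (i : ℕ) + d < j by omega)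
      omega
  have hge : ∀ i : Fin n, stair n i ≤ α i := by
    intro i
    have hi := i.2
    have := key (n - 1 - i) i ⟨n - 1, by omega⟩ (by simp only; omega)
    simp only [stair]
    omega
  refine ⟨⟨fun i => α i - stair n i, ?_⟩, ?_⟩
  · intro i j hij
    have h1 : (i : ℕ) ≤ j := hij
    have h2 := key (j - i) i j (by omega)
    have h3 := hge i
    have h4 := hge j
    have h5 := j.2
    simp only [stair] at h3 h4 ⊢
    omega
  · funext i
    have := hge i
    simp only [Pi.add_apply]
    omega

theorem alternant_eq_zero {n : ℕ} {α : Fin n → ℕ} (hα : ¬ Function.Injective α) :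
    alternant α = 0 := by
  simp only [Function.Injective, not_forall] at hα
  obtain ⟨i, j, h, hij⟩ := hα
  rw [alternant_eq_det]
  refine Matrix.det_zero_of_column_eq hij fun k => ?_
  simp [h]

theorem alternant_mem_span {n : ℕ} (α : Fin n → ℕ) :
    alternant α ∈ Submodule.span ℚ
      (Set.range fun l : Part n => alternant (l.1 + stair n)) := by
  by_cases hα : Function.Injective α
  · set τ : Equiv.Perm (Fin n) := Tuple.sort α * Fin.revPerm with hτ
    have hs : StrictAnti (α ∘ τ) := by
      have hm : Monotone (α ∘ Tuple.sort α) := Tuple.monotone_sort α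
      have hm' : StrictMono (α ∘ Tuple.sort α) :=
        hm.strictMono_of_injective (hα.comp (Tuple.sort α).injective)
      intro i j hij
      exact hm' (Fin.rev_lt_rev.2 hij)
    obtain ⟨l, hl⟩ := exists_part_of_strictAnti hs
    have h1 := alternant_comp τ α
    rw [← hl] at h1
    have h2 : alternant α = Equiv.Perm.sign τ • alternant (l.1 + stair n) := by
      rw [h1, smul_smul, Int.units_mul_self, one_smul]
    rw [h2, Units.smul_def]
    exact zsmul_mem (Submodule.subset_span (Set.mem_range_self l)) _
  · rw [alternant_eq_zero hα]
    exact zero_mem _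

theorem mem_span_alternant {n : ℕ} {f : MvPolynomial (Fin n) ℚ}
    (hf : ∀ τ : Equiv.Perm (Fin n), rename τ f = Equiv.Perm.sign τ • f) :
    f ∈ Submodule.span ℚ (Set.range fun l : Part n => alternant (l.1 + stair n)) := by
  have h1 : (Fintype.card (Equiv.Perm (Fin n)) : ℚ) • f
      = ∑ σ : Equiv.Perm (Fin n), Equiv.Perm.sign σ • rename σ f := by
    simp only [hf, smul_smul, Int.units_mul_self, one_smul, Finset.sum_const, Finset.card_univ]
    exact Nat.cast_smul_eq_nsmul _ _ _
  have h2 : ∀ g : MvPolynomial (Fin n) ℚ,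
      ∑ σ : Equiv.Perm (Fin n), Equiv.Perm.sign σ • rename σ g
        ∈ Submodule.span ℚ (Set.range fun l : Part n => alternant (l.1 + stair n)) := by
    intro g
    induction g using MvPolynomial.induction_on' with
    | monomial u a =>
      have h : ∑ σ : Equiv.Perm (Fin n), Equiv.Perm.sign σ • rename σ (monomial u a)
          = a • alternant (fun i => u i) := by
        rw [alternant, Finset.smul_sum]
        refine Finset.sum_congr rfl fun σ _ => ?_
        rw [monomial_eq, Finsupp.prod_fintype _ _ (by simp), smul_comm]
        simp [smul_eq_C_mul]
      rw [h]
      exact Submodule.smul_mem _ _ (alternant_mem_span _)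
    | add p q hp hq =>
      simp only [map_add, smul_add, Finset.sum_add_distrib]
      exact add_mem hp hq
  have h3 := Submodule.smul_mem _ (Fintype.card (Equiv.Perm (Fin n)) : ℚ)⁻¹ (h1 ▸ h2 f)
  rwa [smul_smul, inv_mul_cancel₀ (by simp [Fintype.card_ne_zero]), one_smul] at h3

theorem mem_span_schur {n : ℕ} {f : MvPolynomial (Fin n) ℚ} (hf : f.IsSymmetric) :
    f ∈ Submodule.span ℚ (Set.range (schur : Part n → MvPolynomial (Fin n) ℚ)) := by
  have h : alternant (stair n) * f ∈ Submodule.span ℚ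
      (Set.range fun l : Part n => alternant (l.1 + stair n)) := by
    refine mem_span_alternant fun τ => ?_
    rw [map_mul, rename_alternant, hf τ, smul_mul_assoc]
  have h' : (Set.range fun l : Part n => alternant (l.1 + stair n))
      = LinearMap.mulLeft ℚ (alternant (stair n)) '' Set.range (schur : Part n → MvPolynomial (Fin n) ℚ) := by
    rw [← Set.range_comp]
    congr 1
    funext l
    exact (alternant_stair_mul_schur l).symm
  rw [h', Submodule.span_image] at h
  obtain ⟨g, hg, hgf⟩ := h
  rwa [← mul_left_cancel₀ (alternant_stair_ne_zero n) hgf]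

/-- The Littlewood–Richardson coefficient `c^λ_{μν}`: the coefficient of `s_λ` in the expansion of
`s_μ s_ν` in the linearly independent family of Schur polynomials. -/
noncomputable def lrCoeff {n : ℕ} (l m v : Part n) : ℚ :=
  (schur_linearIndependent n).repr
    ⟨schur m * schur v,
      mem_span_schur ((schur_isSymmetric m).mul (schur_isSymmetric v))⟩ l

theorem schur_mul_schur {n : ℕ} (m v : Part n) :
    {l : Part n | lrCoeff l m v ≠ 0}.Finite ∧
      schur m * schur v = ∑ᶠ l : Part n, lrCoeff l m v • schur l := by
  set c := (schur_linearIndependent n).repr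
    ⟨schur m * schur v,
      mem_span_schur ((schur_isSymmetric m).mul (schur_isSymmetric v))⟩ with hc
  have h0 : ∀ l, lrCoeff l m v = c l := fun l => rfl
  have hfin : {l : Part n | lrCoeff l m v ≠ 0}.Finite := by
    refine c.support.finite_toSet.subset fun l hl => ?_
    rw [Finset.mem_coe, Finsupp.mem_support_iff, ← h0]
    exact hl
  refine ⟨hfin, ?_⟩
  have h1 := (schur_linearIndependent n).linearCombination_repr
    ⟨schur m * schur v,
      mem_span_schur ((schur_isSymmetric m).mul (schur_isSymmetric v))⟩
  rw [← hc, Finsupp.linearCombination_apply] at h1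
  rw [← show c.sum (fun i a => a • schur i) = schur m * schur v from h1]
  simp only [h0]
  rw [finsum_eq_sum_of_support_subset (s := c.support)]
  · rfl
  · intro l hl
    rw [Finset.mem_coe, Finsupp.mem_support_iff]
    intro h
    exact hl (by simp [h])

/-- The power series `∏ i, (1 + x_i t) (1 + x_i t + x_i² t² + ⋯)` in `t`. -/
noncomputable def qSeries {ι R : Type*} [Fintype ι] [CommRing R] (x : ι → R) : PowerSeries R :=
  ∏ i, (1 + PowerSeries.C (x i) * PowerSeries.X) * PowerSeries.mk fun k => x i ^ k

/-- `q_r(x)`: the coefficient of `t^r` in `qSeries x` for `r ≥ 0`, and `0` for `r < 0`. -/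
noncomputable def q {ι R : Type*} [Fintype ι] [CommRing R] (x : ι → R) (r : ℤ) : R :=
  if r < 0 then 0 else PowerSeries.coeff r.toNat (qSeries x)

/-- The 2-reduced Schur polynomial `S_λ(x) = det (q_{λ_i - i + j}(x))`, with as many rows as there
are variables. -/
noncomputable def reducedSchur {n : ℕ} {R : Type*} [CommRing R] (x : Fin n → R)
    (l : Fin n → ℕ) : R :=
  (Matrix.of fun i j : Fin n => q x ((l i : ℤ) - (i : ℤ) + (j : ℤ))).det

/-- `Q_{(r,s)}(x)`. -/
noncomputable def schurQ₂ {ι R : Type*} [Fintype ι] [CommRing R] (x : ι → R) (r s : ℕ) : R :=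
  if r = 0 ∧ s = 0 then 0
  else q x r * q x s + 2 * ∑ i ∈ Finset.Icc 1 s, (-1) ^ i * q x ((r : ℤ) + i) * q x ((s : ℤ) - i)

/-- The Pfaffian of a skew-symmetric `2m × 2m` matrix: the signed sum of
`∏ i, A_{σ(2i-1), σ(2i)}` over the permutations `σ` of `{1, …, 2m}` with `σ(2i-1) < σ(2i)` for all
`i` and `σ(1) < σ(3) < ⋯ < σ(2m-1)`. Indices start at `0` in the code. -/
def pfaffian {m : ℕ} {R : Type*} [CommRing R] (A : Matrix (Fin (2 * m)) (Fin (2 * m)) R) : R :=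
  ∑ σ : Equiv.Perm (Fin (2 * m)) with
      (∀ i : Fin m, σ ⟨2 * i, by omega⟩ < σ ⟨2 * i + 1, by omega⟩) ∧
      ∀ i j : Fin m, i < j → σ ⟨2 * i, by omega⟩ < σ ⟨2 * j, by omega⟩,
    Equiv.Perm.sign σ • ∏ i : Fin m, A (σ ⟨2 * i, by omega⟩) (σ ⟨2 * i + 1, by omega⟩)

/-- Schur's `Q`-polynomial `Q_λ(x)` for `λ = (λ_1, …, λ_{2m})` with
`λ_1 ≥ ⋯ ≥ λ_{2m-1} > 0` and `λ_{2m} ≥ 0`. -/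
noncomputable def schurQ {m : ℕ} {ι R : Type*} [Fintype ι] [CommRing R] (x : ι → R)
    (l : Fin (2 * m) → ℕ) : R :=
  pfaffian (Matrix.of fun i j => schurQ₂ x (l i) (l j))

end SchurQ

/-!
Write `F(t) = ∑ q_r(x) t^r = E(t²) + t O(t²)`. The parts `E` and `O` are `evenPart (qSeries x)` and
`oddPart (qSeries x)`, and `F(t) F(-t) = 1` says that `E² - y O² = 1` (`evenPart_sq_sub`).
Expanding the `2 × 2` determinants, `S_{2μ+Δ}` and `S_{2μ+δ}` are the coefficients at `y^{μ+δ}` of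
the antisymmetric series `E(y₁) O(y₂) - O(y₁) E(y₂)` and `y₁ O(y₁) E(y₂) - E(y₁) y₂ O(y₂)`
(`reducedSchur_two_one`, `reducedSchur_one_zero`). In other words, `∑_μ a_{μ+δ}(y) S_{2μ+Δ}(x)` is
the first of these series, and similarly for the second (`sum_coeff_alternant_smul_wedge`).

On the other hand `(y₁ - y₂) ∑_λ c^λ_{μν} a_{λ+δ}(y) = a_{μ+δ}(y) a_{ν+δ}(y)`, which is a recurrence
for the coefficients `c^λ_{μν}` (`altCoeff_succ`). It shows that only finitely many pairs `(μ, ν)`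
contribute to a given `λ`, and that the sums in question are the coefficients of the quotient by
`y₁ - y₂` of a product of two such antisymmetric series (`sum_altCoeff_smul_wedge`). The
coefficients of this product involve only `E²`, `O²` and `E O`. Since the generating series in the
doubled variables is `F²`, with even part `2 E² - 1 = 1 + 2 y O²` and odd part `2 E O`, they are
quadratic in the `q_r(x, x)` (`four_mul_wedgeMul_even_odd`, `four_mul_wedgeMul_odd_even`).

Schur's recurrence for `Q_{(r,s)}`, used in the form `schurQ₂_add_two` which moves two units from
one index to the other, is then the same recurrence with the same initial values.
-/

namespace SchurQ

/-! ### Parts of even and odd index of a power series -/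

section Parity

open PowerSeries

variable {R : Type*} [CommRing R]

/-- The series `∑ f_{2m} y^m` formed by the coefficients of even index. -/
noncomputable def evenPart (f : PowerSeries R) : PowerSeries R :=
  PowerSeries.mk fun m => coeff (2 * m) f

/-- The series `∑ f_{2m+1} y^m` formed by the coefficients of odd index. -/
noncomputable def oddPart (f : PowerSeries R) : PowerSeries R :=
  PowerSeries.mk fun m => coeff (2 * m + 1) f

theorem coeff_two_mul_expand_add (E O : PowerSeries R) (m : ℕ) :
    coeff (2 * m) (expand 2 two_ne_zero E + X * expand 2 two_ne_zero O) = coeff m E := by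
  rw [map_add, coeff_expand_mul]
  cases m with
  | zero => simp
  | succ k =>
    rw [show 2 * (k + 1) = (2 * k + 1) + 1 by ring, coeff_succ_X_mul,
      coeff_expand_of_not_dvd _ _ _ (by omega), add_zero]

theorem coeff_two_mul_add_one_expand_add (E O : PowerSeries R) (m : ℕ) :
    coeff (2 * m + 1) (expand 2 two_ne_zero E + X * expand 2 two_ne_zero O) = coeff m O := by
  rw [map_add, coeff_succ_X_mul, coeff_expand_mul, coeff_expand_of_not_dvd _ _ _ (by omega),
    zero_add]

theorem evenPart_expand_add (E O : PowerSeries R) :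
    evenPart (expand 2 two_ne_zero E + X * expand 2 two_ne_zero O) = E := by
  ext m
  rw [evenPart, coeff_mk, coeff_two_mul_expand_add]

theorem oddPart_expand_add (E O : PowerSeries R) :
    oddPart (expand 2 two_ne_zero E + X * expand 2 two_ne_zero O) = O := by
  ext m
  rw [oddPart, coeff_mk, coeff_two_mul_add_one_expand_add]

theorem expand_evenPart_add (f : PowerSeries R) :
    expand 2 two_ne_zero (evenPart f) + X * expand 2 two_ne_zero (oddPart f) = f := by
  ext n
  obtain ⟨m, rfl | rfl⟩ := n.even_or_odd'
  · rw [coeff_two_mul_expand_add, evenPart, coeff_mk]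
  · rw [coeff_two_mul_add_one_expand_add, oddPart, coeff_mk]

theorem evalNegHom_eq (f : PowerSeries R) :
    evalNegHom f = expand 2 two_ne_zero (evenPart f) + X * expand 2 two_ne_zero (-oddPart f) := by
  ext n
  rw [evalNegHom, coeff_rescale]
  obtain ⟨m, rfl | rfl⟩ := n.even_or_odd'
  · rw [coeff_two_mul_expand_add, evenPart, coeff_mk]
    simp
  · rw [coeff_two_mul_add_one_expand_add, oddPart, map_neg, coeff_mk]
    simp [pow_succ]

theorem expand_add_mul_expand_add (E O E' O' : PowerSeries R) :
    (expand 2 two_ne_zero E + X * expand 2 two_ne_zero O) *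
        (expand 2 two_ne_zero E' + X * expand 2 two_ne_zero O')
      = expand 2 two_ne_zero (E * E' + X * (O * O'))
        + X * expand 2 two_ne_zero (E * O' + O * E') := by
  simp only [map_add, map_mul, expand_X]
  ring

theorem evenPart_mul_self (f : PowerSeries R) :
    evenPart (f * f) = evenPart f * evenPart f + X * (oddPart f * oddPart f) := by
  conv_lhs => rw [← expand_evenPart_add f, expand_add_mul_expand_add, evenPart_expand_add]

theorem oddPart_mul_self (f : PowerSeries R) :
    oddPart (f * f) = 2 * (evenPart f * oddPart f) := by
  conv_lhs => rw [← expand_evenPart_add f, expand_add_mul_expand_add, oddPart_expand_add]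
  ring

/-- The relation `f(t) f(-t) = 1` in terms of the parts of even and odd index. -/
theorem evenPart_sq_sub {f : PowerSeries R} (hf : f * evalNegHom f = 1) :
    evenPart f * evenPart f - X * (oddPart f * oddPart f) = 1 := by
  have h := congrArg evenPart hf
  rw [evalNegHom_eq] at h
  conv_lhs at h => rw [← expand_evenPart_add f]
  rw [evenPart_expand_add, oddPart_expand_add, expand_add_mul_expand_add,
    evenPart_expand_add] at h
  rw [show (1 : PowerSeries R)
    = expand 2 two_ne_zero 1 + X * expand 2 two_ne_zero 0 by simp, evenPart_expand_add] at h
  rw [← h]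
  ring

end Parity

/-! ### The coefficients `q_r` and Schur's `Q_{(r,s)}` -/

section QSeries

open PowerSeries

variable {ι R : Type*} [Fintype ι] [CommRing R]

theorem q_natCast (x : ι → R) (k : ℕ) : q x k = coeff k (qSeries x) := by
  simp [q]

theorem q_of_neg (x : ι → R) {k : ℤ} (hk : k < 0) : q x k = 0 := if_pos hk

theorem mk_pow_mul_one_sub (a : R) :
    (PowerSeries.mk fun k => a ^ k) * (1 - C a * X) = 1 := by
  have h := congrArg (rescale a) (mk_one_mul_one_sub_eq_one R)
  have hr : rescale a (PowerSeries.mk 1) = PowerSeries.mk fun k => a ^ k := by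
    ext k
    simp
  rwa [map_mul, map_sub, map_one, rescale_X, hr] at h

theorem qSeries_mul_evalNegHom (x : ι → R) : qSeries x * evalNegHom (qSeries x) = 1 := by
  rw [qSeries, map_prod, ← Finset.prod_mul_distrib]
  refine Finset.prod_eq_one fun i _ => ?_
  have h1 := mk_pow_mul_one_sub (x i)
  have h2 := congrArg evalNegHom h1
  have hC : evalNegHom (C (x i)) = C (x i) := by
    ext k
    rw [evalNegHom, coeff_rescale, coeff_C]
    split_ifs with h <;> simp [h]
  rw [map_mul, map_sub, map_mul, map_one, evalNegHom_X, hC] at h2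
  rw [map_mul, map_add, map_mul, map_one, evalNegHom_X, hC]
  linear_combination (1 + C (x i) * X) * evalNegHom (mk fun k => x i ^ k) * h1 + h2

theorem q_zero (x : ι → R) : q x 0 = 1 := by
  simp [q, qSeries, PowerSeries.coeff_zero_eq_constantCoeff, map_prod]

theorem schurQ₂_zero_right (x : ι → R) (r : ℕ) : schurQ₂ x (r + 1) 0 = q x (r + 1 : ℕ) := by
  simp [schurQ₂, q_zero]

theorem qSeries_sumElim (x : ι → R) : qSeries (Sum.elim x x) = qSeries x * qSeries x := by
  simp [qSeries, Fintype.prod_sum_type]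

/-- The coefficient form of `(t + u) ∑ Q_{(r,s)} t^r u^s = (t - u) (F(t) F(u) - 1)`, where
`F = ∑ q_r t^r`. -/
theorem schurQ₂_succ_add (x : ι → R) (r s : ℕ) :
    schurQ₂ x r (s + 1) + schurQ₂ x (r + 1) s
      = q x r * q x (s + 1 : ℕ) - q x (r + 1 : ℕ) * q x s := by
  have hr : ∀ (n : ℕ) (f : ℕ → R),
      ∑ i ∈ Finset.Icc 1 n, f i = ∑ i ∈ Finset.range n, f (i + 1) := by
    intro n f
    induction n with
    | zero => simp
    | succ n ih => rw [Finset.sum_Icc_succ_top (by omega), Finset.sum_range_succ, ih]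
  have key : ∑ i ∈ Finset.Icc 1 (s + 1),
        (-1 : R) ^ i * q x ((r : ℤ) + i) * q x (((s + 1 : ℕ) : ℤ) - i)
      = -(q x (r + 1 : ℕ) * q x s) - ∑ i ∈ Finset.Icc 1 s,
        (-1 : R) ^ i * q x (((r + 1 : ℕ) : ℤ) + i) * q x ((s : ℤ) - i) := by
    rw [hr, hr, Finset.sum_range_succ', add_comm, sub_eq_add_neg (-_) (∑ i ∈ _, _),
      ← Finset.sum_neg_distrib]
    congr 1
    · simp
    · refine Finset.sum_congr rfl fun i _ => ?_
      rw [show (r : ℤ) + ((i + 1 + 1 : ℕ) : ℤ) = ((r + 1 : ℕ) : ℤ) + ((i + 1 : ℕ) : ℤ) by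
          push_cast; ring,
        show ((s + 1 : ℕ) : ℤ) - ((i + 1 + 1 : ℕ) : ℤ) = (s : ℤ) - ((i + 1 : ℕ) : ℤ) by
          push_cast; ring]
      ring
  rw [schurQ₂, schurQ₂, if_neg (by omega), if_neg (by omega), key]
  ring

/-- Schur's recurrence for `Q_{(r,s)}`, iterated once so that it preserves the parities of
`r` and `s`. -/
theorem schurQ₂_add_two (x : ι → R) (r s : ℕ) :
    schurQ₂ x r (s + 2) = q x r * q x (s + 2 : ℕ) - 2 * (q x (r + 1 : ℕ) * q x (s + 1 : ℕ))
      + q x (r + 2 : ℕ) * q x s + schurQ₂ x (r + 2) s := by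
  have h1 := schurQ₂_succ_add x r (s + 1)
  have h2 := schurQ₂_succ_add x (r + 1) s
  linear_combination h1 - h2

theorem pfaffian_one (A : Matrix (Fin (2 * 1)) (Fin (2 * 1)) R) :
    pfaffian (m := 1) A = A 0 1 := by
  have h : (Finset.univ.filter fun σ : Equiv.Perm (Fin (2 * 1)) =>
      (∀ i : Fin 1, σ ⟨2 * i, by omega⟩ < σ ⟨2 * i + 1, by omega⟩) ∧
      ∀ i j : Fin 1, i < j → σ ⟨2 * i, by omega⟩ < σ ⟨2 * j, by omega⟩) = {1} := by
    decide
  rw [pfaffian, h]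
  simp

end QSeries

/-! ### Alternants in two variables -/

section Alternants

open MvPolynomial

/-- The exponent vector of `x_1^i x_2^j`. -/
noncomputable def expo (i j : ℕ) : Fin 2 →₀ ℕ := Finsupp.single 0 i + Finsupp.single 1 j

theorem expo_inj {i j k l : ℕ} : expo i j = expo k l ↔ i = k ∧ j = l := by
  refine ⟨fun h => ⟨?_, ?_⟩, fun h => by rw [h.1, h.2]⟩
  · simpa [expo] using DFunLike.congr_fun h 0
  · simpa [expo] using DFunLike.congr_fun h 1

theorem expo_add (i j k l : ℕ) : expo i j + expo k l = expo (i + k) (j + l) := by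
  simp only [expo, Finsupp.single_add]
  abel

theorem expo_apply (a : Fin 2 →₀ ℕ) : expo (a 0) (a 1) = a := by
  ext k
  fin_cases k <;> simp [expo]

theorem alternant_two (α : Fin 2 → ℕ) :
    alternant α = X 0 ^ α 0 * X 1 ^ α 1 - X 1 ^ α 0 * X 0 ^ α 1 := by
  rw [alternant_eq_det, Matrix.det_fin_two]
  simp
  ring

theorem alternant_stair_two : alternant (stair 2) = (X 0 - X 1 : MvPolynomial (Fin 2) ℚ) := by
  rw [alternant_two]
  simp [stair]

theorem coeff_alternant_two (α : Fin 2 → ℕ) (i j : ℕ) :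
    coeff (expo i j) (alternant α)
      = (if α 0 = i ∧ α 1 = j then 1 else 0) - (if α 1 = i ∧ α 0 = j then 1 else 0) := by
  have h : ∀ k l : ℕ, (X 0 ^ k * X 1 ^ l : MvPolynomial (Fin 2) ℚ) = monomial (expo k l) 1 := by
    intro k l
    rw [X_pow_eq_monomial, X_pow_eq_monomial, monomial_mul, one_mul, expo]
  rw [alternant_two, mul_comm (X 1 ^ α 0), h, h, coeff_sub, coeff_monomial, coeff_monomial]
  simp only [expo_inj]

theorem coeff_alternant_add_stair (m : Part 2) (i j : ℕ) :
    coeff (expo i j) (alternant (m.1 + stair 2))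
      = (if m.1 0 + 1 = i ∧ m.1 1 = j then 1 else 0)
        - (if m.1 1 = i ∧ m.1 0 + 1 = j then 1 else 0) := by
  rw [coeff_alternant_two]
  simp [stair]

theorem sum_antidiagonal_expo {M : Type*} [AddCommMonoid M] (i j : ℕ)
    (F : (Fin 2 →₀ ℕ) → (Fin 2 →₀ ℕ) → M) :
    ∑ a ∈ Finset.HasAntidiagonal.antidiagonal (expo i j), F a.1 a.2
      = ∑ a ∈ Finset.HasAntidiagonal.antidiagonal i ×ˢ Finset.HasAntidiagonal.antidiagonal j,
          F (expo a.1.1 a.2.1) (expo a.1.2 a.2.2) := by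
  refine Finset.sum_nbij' (fun a => ((a.1 0, a.2 0), (a.1 1, a.2 1)))
    (fun a => (expo a.1.1 a.2.1, expo a.1.2 a.2.2)) ?_ ?_ ?_ ?_ ?_
  · intro a ha
    rw [Finset.HasAntidiagonal.mem_antidiagonal] at ha
    have h0 := DFunLike.congr_fun ha 0
    have h1 := DFunLike.congr_fun ha 1
    simp [expo] at h0 h1
    simp [h0, h1]
  · intro a ha
    simp only [Finset.mem_product, Finset.HasAntidiagonal.mem_antidiagonal] at ha ⊢
    rw [expo_add, ha.1, ha.2]
  · intro a _
    simp [expo_apply]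
  · intro a _
    simp [expo]
  · intro a _
    simp [expo_apply]

/-! ### The recurrence for Littlewood–Richardson coefficients -/

/-- The coefficient of `x_1^i x_2^j` in `a_δ s_m s_v`, which is `c^l_{mv}` when
`(i, j) = l + δ`. Unlike `c^l_{mv}` it is defined for every pair `(i, j)`. -/
noncomputable def altCoeff (m v : Part 2) (i j : ℕ) : ℚ :=
  coeff (expo i j) (alternant (stair 2) * (schur m * schur v))

theorem lrCoeff_eq_altCoeff (l m v : Part 2) :
    lrCoeff l m v = altCoeff m v (l.1 0 + 1) (l.1 1) := by
  obtain ⟨hfin, h⟩ := schur_mul_schur m v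
  have he : expo (l.1 0 + 1) (l.1 1) = Finsupp.equivFunOnFinite.symm (l.1 + stair 2) := by
    ext k
    fin_cases k <;> simp [expo, stair]
  rw [finsum_eq_sum_of_support_subset (s := hfin.toFinset) _ (by
    intro k hk
    simp only [Set.Finite.coe_toFinset, Set.mem_ofPred_eq]
    intro h0
    exact hk (by simp [h0]))] at h
  rw [altCoeff, h, he, Finset.mul_sum, coeff_sum]
  simp only [mul_smul_comm, alternant_stair_mul_schur, coeff_smul,
    coeff_alternant (strictAnti_add_stair _) (strictAnti_add_stair _), add_left_inj,
    Subtype.val_inj]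
  simp only [smul_eq_mul, mul_ite, mul_one, mul_zero, Finset.sum_ite_eq',
    Set.Finite.mem_toFinset, Set.mem_ofPred_eq]
  split_ifs with h0
  · rfl
  · simpa using h0

theorem coeff_X_sub_X_mul_zero (P : MvPolynomial (Fin 2) ℚ) (i : ℕ) :
    coeff (expo (i + 1) 0) ((X 0 - X 1) * P) = coeff (expo i 0) P := by
  have h : expo (i + 1) 0 = Finsupp.single 0 1 + expo i 0 := by
    simp [expo, add_comm]
  rw [sub_mul, coeff_sub, coeff_X_mul' _ 1, if_neg (by simp [expo]), sub_zero, h, coeff_X_mul]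

theorem coeff_X_sub_X_mul_succ (P : MvPolynomial (Fin 2) ℚ) (i j : ℕ) :
    coeff (expo (i + 1) (j + 1)) ((X 0 - X 1) * P)
      = coeff (expo i (j + 1)) P - coeff (expo (i + 1) j) P := by
  have h0 : expo (i + 1) (j + 1) = Finsupp.single 0 1 + expo i (j + 1) := by
    rw [expo, expo, add_comm i, Finsupp.single_add, add_assoc]
  have h1 : expo (i + 1) (j + 1) = Finsupp.single 1 1 + expo (i + 1) j := by
    rw [expo, expo, Finsupp.single_add 1 j]
    abel
  rw [sub_mul, coeff_sub]
  conv_lhs => 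
    congr
    · rw [h0, coeff_X_mul]
    · rw [h1, coeff_X_mul]

theorem X_sub_X_mul_alternant_mul_schur (m v : Part 2) :
    (X 0 - X 1) * (alternant (stair 2) * (schur m * schur v))
      = alternant (m.1 + stair 2) * alternant (v.1 + stair 2) := by
  rw [← alternant_stair_mul_schur, ← alternant_stair_mul_schur, ← alternant_stair_two]
  ring

/-- Comparing coefficients in `(x_1 - x_2) a_δ s_m s_v = a_{m+δ} a_{v+δ}`; this is the start
`j = 0` of the recursion on `j` that `altCoeff_succ` continues. -/
theorem altCoeff_zero (m v : Part 2) (i : ℕ) :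
    altCoeff m v i 0
      = coeff (expo (i + 1) 0) (alternant (m.1 + stair 2) * alternant (v.1 + stair 2)) := by
  rw [← X_sub_X_mul_alternant_mul_schur, coeff_X_sub_X_mul_zero, altCoeff]

theorem altCoeff_succ (m v : Part 2) (i j : ℕ) :
    altCoeff m v i (j + 1)
      = coeff (expo (i + 1) (j + 1)) (alternant (m.1 + stair 2) * alternant (v.1 + stair 2))
        + altCoeff m v (i + 1) j := by
  rw [← X_sub_X_mul_alternant_mul_schur, coeff_X_sub_X_mul_succ, altCoeff, altCoeff, sub_add_cancel]

theorem size_le_of_coeff_mul_ne_zero {m v : Part 2} {i j : ℕ}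
    (h : coeff (expo i j) (alternant (m.1 + stair 2) * alternant (v.1 + stair 2)) ≠ 0) :
    m.1 0 + m.1 1 + 1 ≤ i + j ∧ v.1 0 + v.1 1 + 1 ≤ i + j := by
  have hne : ∀ (l : Part 2) (a b : ℕ), coeff (expo a b) (alternant (l.1 + stair 2)) ≠ 0 →
      l.1 0 + l.1 1 + 1 = a + b := by
    intro l a b hl
    rw [coeff_alternant_add_stair] at hl
    by_contra hab
    exact hl (by rw [if_neg (by omega), if_neg (by omega), sub_zero])
  rw [coeff_mul, sum_antidiagonal_expo i j fun a b =>
    coeff a (alternant (m.1 + stair 2)) * coeff b (alternant (v.1 + stair 2))] at h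
  obtain ⟨a, ha, hne0⟩ := Finset.exists_ne_zero_of_sum_ne_zero h
  have h1 := hne m _ _ (left_ne_zero_of_mul hne0)
  have h2 := hne v _ _ (right_ne_zero_of_mul hne0)
  simp only [Finset.mem_product, Finset.HasAntidiagonal.mem_antidiagonal] at ha
  omega

theorem size_le_of_altCoeff_ne_zero {m v : Part 2} {i j : ℕ} (h : altCoeff m v i j ≠ 0) :
    m.1 0 + m.1 1 ≤ i + j ∧ v.1 0 + v.1 1 ≤ i + j := by
  induction j generalizing i with
  | zero =>
    rw [altCoeff_zero] at h
    have := size_le_of_coeff_mul_ne_zero h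
    omega
  | succ j ih =>
    by_cases h0 : altCoeff m v (i + 1) j = 0
    · rw [altCoeff_succ, h0, add_zero] at h
      have := size_le_of_coeff_mul_ne_zero h
      omega
    · have := ih h0
      omega

theorem finite_size_le (N : ℕ) : {m : Part 2 | m.1 0 + m.1 1 ≤ N}.Finite := by
  refine ((Set.finite_Iic (fun _ : Fin 2 => N)).preimage
    Subtype.val_injective.injOn).subset fun m hm => ?_
  simp only [Set.mem_ofPred_eq] at hm
  intro k
  fin_cases k <;> simp only [Fin.zero_eta, Fin.mk_one] <;> omega

/-- The partitions of length at most two and size at most `N`. -/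
noncomputable def partsLE (N : ℕ) : Finset (Part 2) := (finite_size_le N).toFinset

theorem mem_partsLE {N : ℕ} {m : Part 2} : m ∈ partsLE N ↔ m.1 0 + m.1 1 ≤ N := by
  simp [partsLE]

/-! ### Summation against Littlewood–Richardson coefficients -/

section Pairing

variable {R : Type*} [CommRing R]

/-- The coefficient of `y_1^i y_2^j` in `U(y_1) V(y_2) - V(y_1) U(y_2)`. -/
noncomputable def wedge (U V : PowerSeries R) (i j : ℕ) : R :=
  PowerSeries.coeff i U * PowerSeries.coeff j V - PowerSeries.coeff i V * PowerSeries.coeff j U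

/-- The coefficient of `y_1^i y_2^j` in the product of `U(y_1) V(y_2) - V(y_1) U(y_2)` and
`U'(y_1) V'(y_2) - V'(y_1) U'(y_2)`. -/
noncomputable def wedgeMul (U V U' V' : PowerSeries R) (i j : ℕ) : R :=
  PowerSeries.coeff i (U * U') * PowerSeries.coeff j (V * V')
    - PowerSeries.coeff i (U * V') * PowerSeries.coeff j (V * U')
    - PowerSeries.coeff i (V * U') * PowerSeries.coeff j (U * V')
    + PowerSeries.coeff i (V * V') * PowerSeries.coeff j (U * U')

theorem sum_wedge_mul_wedge (U V U' V' : PowerSeries R) (i j : ℕ) :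
    ∑ a ∈ Finset.HasAntidiagonal.antidiagonal i ×ˢ Finset.HasAntidiagonal.antidiagonal j,
      wedge U V a.1.1 a.2.1 * wedge U' V' a.1.2 a.2.2 = wedgeMul U V U' V' i j := by
  simp only [wedgeMul, PowerSeries.coeff_mul, Finset.sum_mul_sum, ← Finset.sum_product',
    ← Finset.sum_sub_distrib, ← Finset.sum_add_distrib]
  refine Finset.sum_congr rfl fun a _ => ?_
  simp only [wedge]
  ring

variable [Algebra ℚ R]

/-- The alternants `a_{m+δ}(y)` expand the antisymmetric series `U(y_1) V(y_2) - V(y_1) U(y_2)`,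
with its coefficients at the strictly decreasing exponents `m + δ`. -/
theorem sum_coeff_alternant_smul_wedge (U V : PowerSeries R) {N i j : ℕ} (h : i + j ≤ N + 1) :
    ∑ m ∈ partsLE N, coeff (expo i j) (alternant (m.1 + stair 2)) •
      wedge U V (m.1 0 + 1) (m.1 1) = wedge U V i j := by
  have hanti : ∀ m : Part 2, m.1 1 ≤ m.1 0 := fun m => m.2 (Fin.zero_le 1)
  have hpart : ∀ a b : ℕ, b < a → ∃ m : Part 2, m.1 0 + 1 = a ∧ m.1 1 = b := by
    intro a b hab
    refine ⟨⟨![a - 1, b], ?_⟩, ?_, ?_⟩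
    · intro k l hkl
      fin_cases k <;> fin_cases l <;> simp at hkl ⊢
      omega
    · simp only [Matrix.cons_val_zero]
      omega
    · simp
  have hext : ∀ m m' : Part 2, m.1 0 = m'.1 0 → m.1 1 = m'.1 1 → m = m' := by
    intro m m' h0 h1
    refine Subtype.ext (funext fun k => ?_)
    fin_cases k <;> assumption
  simp only [coeff_alternant_add_stair]
  rcases lt_trichotomy i j with hij | rfl | hij
  · obtain ⟨n, h0, h1⟩ := hpart j i hij
    rw [Finset.sum_eq_single n]
    · rw [if_neg (by omega), if_pos ⟨h1, h0⟩, zero_sub, neg_smul, one_smul, h0, h1]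
      simp only [wedge]
      ring
    · intro m _ hm
      have := hanti m
      rw [if_neg (by omega), if_neg fun hh => hm (hext m n (by omega) (by omega)), sub_zero,
        zero_smul]
    · intro hn
      exact absurd (mem_partsLE.2 (by omega)) hn
  · rw [Finset.sum_eq_zero]
    · simp only [wedge]
      ring
    · intro m _
      have := hanti m
      rw [if_neg (by omega), if_neg (by omega), sub_zero, zero_smul]
  · obtain ⟨n, h0, h1⟩ := hpart i j hij
    rw [Finset.sum_eq_single n]
    · rw [if_pos ⟨h0, h1⟩, if_neg (by omega), sub_zero, one_smul, h0, h1]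
    · intro m _ hm
      have := hanti m
      rw [if_neg fun hh => hm (hext m n (by omega) (by omega)), if_neg (by omega), sub_zero,
        zero_smul]
    · intro hn
      exact absurd (mem_partsLE.2 (by omega)) hn

theorem sum_coeff_mul_smul_wedge (U V U' V' : PowerSeries R) {N i j : ℕ} (h : i + j ≤ N + 1) :
    ∑ p ∈ partsLE N ×ˢ partsLE N,
      coeff (expo i j) (alternant (p.1.1 + stair 2) * alternant (p.2.1 + stair 2)) •
        (wedge U V (p.1.1 0 + 1) (p.1.1 1) * wedge U' V' (p.2.1 0 + 1) (p.2.1 1))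
      = wedgeMul U V U' V' i j := by
  have hc : ∀ p : Part 2 × Part 2,
      coeff (expo i j) (alternant (p.1.1 + stair 2) * alternant (p.2.1 + stair 2))
      = ∑ a ∈ Finset.HasAntidiagonal.antidiagonal i ×ˢ Finset.HasAntidiagonal.antidiagonal j,
        coeff (expo a.1.1 a.2.1) (alternant (p.1.1 + stair 2)) *
          coeff (expo a.1.2 a.2.2) (alternant (p.2.1 + stair 2)) := by
    intro p
    rw [coeff_mul, sum_antidiagonal_expo i j fun a b =>
      coeff a (alternant (p.1.1 + stair 2)) * coeff b (alternant (p.2.1 + stair 2))]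
  simp only [hc, Finset.sum_smul]
  rw [Finset.sum_comm, ← sum_wedge_mul_wedge]
  refine Finset.sum_congr rfl fun a ha => ?_
  simp only [Finset.mem_product, Finset.HasAntidiagonal.mem_antidiagonal] at ha
  rw [← sum_coeff_alternant_smul_wedge U V (N := N) (i := a.1.1) (j := a.2.1) (by omega),
    ← sum_coeff_alternant_smul_wedge U' V' (N := N) (i := a.1.2) (j := a.2.2) (by omega),
    Finset.sum_mul_sum, ← Finset.sum_product']
  refine Finset.sum_congr rfl fun p _ => ?_
  rw [smul_mul_smul_comm]

/-- Division of `(U(y_1) V(y_2) - V(y_1) U(y_2)) (U'(y_1) V'(y_2) - V'(y_1) U'(y_2))` by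
`y_1 - y_2`: the coefficients `D i j` of the quotient, given by their recurrence, are the sums
weighted by `altCoeff`. -/
theorem sum_altCoeff_smul_wedge (U V U' V' : PowerSeries R) (D : ℕ → ℕ → R)
    (h0 : ∀ i, D i 0 = wedgeMul U V U' V' (i + 1) 0)
    (hs : ∀ i j, D i (j + 1) = wedgeMul U V U' V' (i + 1) (j + 1) + D (i + 1) j)
    {N i j : ℕ} (h : i + j ≤ N) :
    ∑ p ∈ partsLE N ×ˢ partsLE N, altCoeff p.1 p.2 i j •
        (wedge U V (p.1.1 0 + 1) (p.1.1 1) * wedge U' V' (p.2.1 0 + 1) (p.2.1 1)) = D i j := by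
  induction j generalizing i with
  | zero =>
    simp only [altCoeff_zero]
    rw [sum_coeff_mul_smul_wedge U V U' V' (by omega), h0]
  | succ j ih =>
    simp only [altCoeff_succ, add_smul, Finset.sum_add_distrib]
    rw [sum_coeff_mul_smul_wedge U V U' V' (by omega), ih (by omega), hs]

theorem lrCoeff_support_subset (l : Part 2) :
    {p : Part 2 × Part 2 | lrCoeff l p.1 p.2 ≠ 0}
      ⊆ ↑(partsLE (l.1 0 + 1 + l.1 1) ×ˢ partsLE (l.1 0 + 1 + l.1 1)) := by
  intro p hp
  rw [Set.mem_ofPred_eq, lrCoeff_eq_altCoeff] at hp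
  have := size_le_of_altCoeff_ne_zero hp
  rw [Finset.mem_coe, Finset.mem_product, mem_partsLE, mem_partsLE]
  exact this

/-- The sum over all pairs of partitions, weighted by Littlewood–Richardson coefficients, of two
functions that are given by `2 × 2` determinants in coefficients of power series. -/
theorem finsum_lrCoeff_smul_wedge (U V U' V' : PowerSeries R) (D : ℕ → ℕ → R)
    (h0 : ∀ i, D i 0 = wedgeMul U V U' V' (i + 1) 0)
    (hs : ∀ i j, D i (j + 1) = wedgeMul U V U' V' (i + 1) (j + 1) + D (i + 1) j)
    (l : Part 2) :
    ∑ᶠ p : Part 2 × Part 2, lrCoeff l p.1 p.2 •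
        (wedge U V (p.1.1 0 + 1) (p.1.1 1) * wedge U' V' (p.2.1 0 + 1) (p.2.1 1))
      = D (l.1 0 + 1) (l.1 1) := by
  rw [finsum_eq_sum_of_support_subset _ (fun p hp => lrCoeff_support_subset l (a := p)
    fun h => hp (by simp [h])), ← sum_altCoeff_smul_wedge U V U' V' D h0 hs le_rfl]
  simp only [lrCoeff_eq_altCoeff]

end Pairing

end Alternants

/-! ### 2-reduced Schur polynomials of two rows -/

section Reduced

variable {R : Type*} [CommRing R]

theorem coeff_evenPart_qSeries {ι : Type*} [Fintype ι] (x : ι → R) (m : ℕ) :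
    PowerSeries.coeff m (evenPart (qSeries x)) = q x (2 * m : ℕ) := by
  rw [q_natCast, evenPart, PowerSeries.coeff_mk]

theorem coeff_oddPart_qSeries {ι : Type*} [Fintype ι] (x : ι → R) (m : ℕ) :
    PowerSeries.coeff m (oddPart (qSeries x)) = q x (2 * m + 1 : ℕ) := by
  rw [q_natCast, oddPart, PowerSeries.coeff_mk]

theorem coeff_X_mul_oddPart_qSeries {ι : Type*} [Fintype ι] (x : ι → R) (m : ℕ) :
    PowerSeries.coeff m (PowerSeries.X * oddPart (qSeries x)) = q x (2 * (m : ℤ) - 1) := by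
  cases m with
  | zero => simp [q_of_neg]
  | succ m =>
    rw [PowerSeries.coeff_succ_X_mul, coeff_oddPart_qSeries]
    congr 1
    push_cast
    ring

theorem reducedSchur_two (x : Fin 2 → R) (l : Fin 2 → ℕ) :
    reducedSchur x l = q x (l 0) * q x (l 1) - q x ((l 0 : ℤ) + 1) * q x ((l 1 : ℤ) - 1) := by
  rw [reducedSchur, Matrix.det_fin_two]
  simp

theorem reducedSchur_two_one (x : Fin 2 → R) (l : Part 2) :
    reducedSchur x (2 • l.1 + ![2, 1])
      = wedge (evenPart (qSeries x)) (oddPart (qSeries x)) (l.1 0 + 1) (l.1 1) := by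
  rw [reducedSchur_two, wedge]
  simp only [coeff_evenPart_qSeries, coeff_oddPart_qSeries]
  congr 3
  simp

theorem reducedSchur_one_zero (x : Fin 2 → R) (l : Part 2) :
    reducedSchur x (2 • l.1 + ![1, 0])
      = wedge (PowerSeries.X * oddPart (qSeries x)) (evenPart (qSeries x))
          (l.1 0 + 1) (l.1 1) := by
  rw [reducedSchur_two, wedge]
  simp only [coeff_evenPart_qSeries, coeff_X_mul_oddPart_qSeries]
  congr 3
  simp [mul_add, add_sub_assoc]

end Reduced

/-! ### Quadratic relations with the doubled variables -/

section Quadratic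

variable {R : Type*} [CommRing R] (x : Fin 2 → R)

/-- The even part of `F²`, `F = E(t²) + t O(t²)`, is `E² + y O² = 2 E² - 1`, because
`E² - y O² = 1`; the correction at `i = 0` comes from the constant `1`. -/
theorem two_mul_coeff_even_mul_even (i : ℕ) :
    2 * PowerSeries.coeff i (evenPart (qSeries x) * evenPart (qSeries x))
      = q (Sum.elim x x) (2 * i : ℕ) + if i = 0 then 1 else 0 := by
  rw [← coeff_evenPart_qSeries, qSeries_sumElim, evenPart_mul_self, ← PowerSeries.coeff_one,
    ← evenPart_sq_sub (qSeries_mul_evalNegHom x), map_sub, map_add]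
  ring

theorem two_mul_coeff_X_mul_odd_mul_odd (i : ℕ) :
    2 * PowerSeries.coeff i (PowerSeries.X * (oddPart (qSeries x) * oddPart (qSeries x)))
      = q (Sum.elim x x) (2 * i : ℕ) - if i = 0 then 1 else 0 := by
  rw [← coeff_evenPart_qSeries, qSeries_sumElim, evenPart_mul_self, ← PowerSeries.coeff_one,
    ← evenPart_sq_sub (qSeries_mul_evalNegHom x), map_sub, map_add]
  ring

theorem two_mul_coeff_odd_mul_odd (i : ℕ) :
    2 * PowerSeries.coeff i (oddPart (qSeries x) * oddPart (qSeries x))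
      = q (Sum.elim x x) (2 * i + 2 : ℕ) := by
  have h := two_mul_coeff_X_mul_odd_mul_odd x (i + 1)
  rwa [PowerSeries.coeff_succ_X_mul, if_neg i.succ_ne_zero, sub_zero] at h

theorem two_mul_coeff_even_mul_odd (i : ℕ) :
    2 * PowerSeries.coeff i (evenPart (qSeries x) * oddPart (qSeries x))
      = q (Sum.elim x x) (2 * i + 1 : ℕ) := by
  rw [← coeff_oddPart_qSeries, qSeries_sumElim, oddPart_mul_self, two_mul, two_mul, map_add]

/-- For `j > 0` the right-hand side is the difference `Q_{(2i+2,2j+2)} - Q_{(2i+4,2j)}` in the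
doubled variables, see `schurQ₂_add_two`. -/
theorem four_mul_wedgeMul_even_odd (i j : ℕ) :
    4 * wedgeMul (evenPart (qSeries x)) (oddPart (qSeries x))
        (evenPart (qSeries x)) (oddPart (qSeries x)) (i + 1) j
      = q (Sum.elim x x) (2 * i + 2 : ℕ) * q (Sum.elim x x) (2 * j + 2 : ℕ)
        - 2 * (q (Sum.elim x x) (2 * i + 3 : ℕ) * q (Sum.elim x x) (2 * j + 1 : ℕ))
        + q (Sum.elim x x) (2 * i + 4 : ℕ)
          * (q (Sum.elim x x) (2 * j : ℕ) + if j = 0 then 1 else 0) := by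
  have h1 := two_mul_coeff_even_mul_even x (i + 1)
  rw [if_neg i.succ_ne_zero, add_zero] at h1
  have h2 := two_mul_coeff_odd_mul_odd x (i + 1)
  have h3 := two_mul_coeff_even_mul_odd x (i + 1)
  rw [show 2 * (i + 1) + 2 = 2 * i + 4 by ring] at h2
  rw [show 2 * (i + 1) + 1 = 2 * i + 3 by ring] at h3
  rw [show 2 * (i + 1) = 2 * i + 2 by ring] at h1
  rw [wedgeMul, mul_comm (oddPart _) (evenPart _), ← two_mul_coeff_even_mul_even,
    ← two_mul_coeff_odd_mul_odd x j, ← two_mul_coeff_even_mul_odd x j, ← h1, ← h2, ← h3]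
  ring

/-- For `j > 0` the right-hand side is the difference `Q_{(2i+1,2j+1)} - Q_{(2i+3,2j-1)}` in the
doubled variables, see `schurQ₂_add_two`. -/
theorem four_mul_wedgeMul_odd_even (i j : ℕ) :
    4 * wedgeMul (PowerSeries.X * oddPart (qSeries x)) (evenPart (qSeries x))
        (evenPart (qSeries x)) (oddPart (qSeries x)) (i + 1) j
      = q (Sum.elim x x) (2 * i + 1 : ℕ) * q (Sum.elim x x) (2 * j + 1 : ℕ)
        - 2 * (q (Sum.elim x x) (2 * i + 2 : ℕ) * q (Sum.elim x x) (2 * j : ℕ))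
        + q (Sum.elim x x) (2 * i + 3 : ℕ) * q (Sum.elim x x) (2 * (j : ℤ) - 1) := by
  have h1 := two_mul_coeff_even_mul_even x (i + 1)
  have h2 := two_mul_coeff_X_mul_odd_mul_odd x (i + 1)
  rw [if_neg i.succ_ne_zero] at h1 h2
  have h3 := two_mul_coeff_even_mul_even x j
  have h4 := two_mul_coeff_X_mul_odd_mul_odd x j
  have h5 : 2 * PowerSeries.coeff j
      (PowerSeries.X * (evenPart (qSeries x) * oddPart (qSeries x)))
        = q (Sum.elim x x) (2 * (j : ℤ) - 1) := by
    rw [← coeff_X_mul_oddPart_qSeries, qSeries_sumElim, oddPart_mul_self, two_mul, two_mul,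
      mul_add, map_add]
  have h6 := two_mul_coeff_even_mul_odd x i
  have h7 := two_mul_coeff_even_mul_odd x j
  have h8 := two_mul_coeff_even_mul_odd x (i + 1)
  rw [show 2 * (i + 1) = 2 * i + 2 by ring] at h1 h2 h8
  rw [wedgeMul, mul_assoc PowerSeries.X, mul_assoc PowerSeries.X,
    mul_comm (oddPart _) (evenPart _), PowerSeries.coeff_succ_X_mul, ← h5, ← h6, ← h7, ← h8]
  linear_combination (-(2 * PowerSeries.coeff j
      (evenPart (qSeries x) * evenPart (qSeries x)))) * h2
    - q (Sum.elim x x) (2 * i + 2 : ℕ) * h3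
    - 2 * PowerSeries.coeff j
      (PowerSeries.X * (oddPart (qSeries x) * oddPart (qSeries x))) * h1
    - q (Sum.elim x x) (2 * i + 2 : ℕ) * h4

end Quadratic

/-! ### The two identities -/

section DoubledVariables

variable {R : Type*} [CommRing R] [Algebra ℚ R] (x : Fin 2 → R)

theorem inv_smul_eq_of_four_mul {a b : R} (h : 4 * a = b) : (2 ^ 2 : ℚ)⁻¹ • b = a := by
  rw [inv_smul_eq_iff₀ (by norm_num), ← h, show (2 ^ 2 : ℚ) = 4 by norm_num, Algebra.smul_def,
    map_ofNat]

theorem inv_smul_eq_add_of_four_mul {a b c : R} (h : b = 4 * a + c) :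
    (2 ^ 2 : ℚ)⁻¹ • b = a + (2 ^ 2 : ℚ)⁻¹ • c := by
  rw [h, smul_add, inv_smul_eq_of_four_mul rfl]

/-- The first index is `2 (l_1 + 1) + 2` because the exponents `l + δ = (l_1 + 1, l_2)` are the
indices of the recurrence. -/
theorem finsum_lrCoeff_even (l : Part 2) :
    ∑ᶠ p : Part 2 × Part 2, lrCoeff l p.1 p.2 •
        (reducedSchur x (2 • p.1.1 + ![2, 1]) * reducedSchur x (2 • p.2.1 + ![2, 1]))
      = (2 ^ 2 : ℚ)⁻¹ • schurQ₂ (Sum.elim x x) (2 * (l.1 0 + 1) + 2) (2 * l.1 1 + 2) := by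
  simp only [reducedSchur_two_one]
  refine finsum_lrCoeff_smul_wedge _ _ _ _
    (fun i j => (2 ^ 2 : ℚ)⁻¹ • schurQ₂ (Sum.elim x x) (2 * i + 2) (2 * j + 2)) ?_ ?_ l
  · intro i
    refine inv_smul_eq_of_four_mul ?_
    rw [four_mul_wedgeMul_even_odd, schurQ₂_add_two, schurQ₂_zero_right, if_pos rfl]
    simp only [mul_zero, zero_add, Nat.cast_zero, q_zero]
    ring
  · intro i j
    refine inv_smul_eq_add_of_four_mul ?_
    rw [four_mul_wedgeMul_even_odd, schurQ₂_add_two, if_neg j.succ_ne_zero, add_zero]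
    rfl

theorem finsum_lrCoeff_odd (l : Part 2) :
    ∑ᶠ p : Part 2 × Part 2, lrCoeff l p.1 p.2 •
        (reducedSchur x (2 • p.1.1 + ![1, 0]) * reducedSchur x (2 • p.2.1 + ![2, 1]))
      = (2 ^ 2 : ℚ)⁻¹ • schurQ₂ (Sum.elim x x) (2 * (l.1 0 + 1) + 1) (2 * l.1 1 + 1) := by
  simp only [reducedSchur_two_one, reducedSchur_one_zero]
  refine finsum_lrCoeff_smul_wedge _ _ _ _
    (fun i j => (2 ^ 2 : ℚ)⁻¹ • schurQ₂ (Sum.elim x x) (2 * i + 1) (2 * j + 1)) ?_ ?_ l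
  · intro i
    refine inv_smul_eq_of_four_mul ?_
    -- `schurQ₂_add_two` does not reach `Q_{(r,1)}`; a single step of the recurrence does.
    have h := schurQ₂_succ_add (Sum.elim x x) (2 * i + 1) 0
    rw [schurQ₂_zero_right] at h
    rw [four_mul_wedgeMul_odd_even, q_of_neg _ (show 2 * ((0 : ℕ) : ℤ) - 1 < 0 by norm_num)]
    simp only [mul_zero, zero_add, Nat.cast_zero, q_zero] at h ⊢
    linear_combination -h
  · intro i j
    refine inv_smul_eq_add_of_four_mul ?_
    have h := schurQ₂_add_two (Sum.elim x x) (2 * i + 1) (2 * j + 1)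
    rw [four_mul_wedgeMul_odd_even, show 2 * ((j + 1 : ℕ) : ℤ) - 1 = ((2 * j + 1 : ℕ) : ℤ) by
      push_cast; ring]
    exact h

end DoubledVariables

end SchurQ

theorem mainTheorem1 (l : SchurQ.Part 2) :
    let x : Fin 2 → MvPolynomial (Fin 2) ℚ := MvPolynomial.X
    let xx : Fin 2 ⊕ Fin 2 → MvPolynomial (Fin 2) ℚ := Sum.elim x x
    {p : SchurQ.Part 2 × SchurQ.Part 2 | SchurQ.lrCoeff l p.1 p.2 ≠ 0}.Finite ∧
    ∑ᶠ p : SchurQ.Part 2 × SchurQ.Part 2, SchurQ.lrCoeff l p.1 p.2 •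
        (SchurQ.reducedSchur x (2 • p.1.1 + ![2, 1]) *
          SchurQ.reducedSchur x (2 • p.2.1 + ![2, 1]))
      = (2 ^ 2 : ℚ)⁻¹ • SchurQ.schurQ (m := 1) xx (2 • l.1 + 2 • ![2, 1]) ∧
    ∑ᶠ p : SchurQ.Part 2 × SchurQ.Part 2, SchurQ.lrCoeff l p.1 p.2 •
        (SchurQ.reducedSchur x (2 • p.1.1 + ![1, 0]) *
          SchurQ.reducedSchur x (2 • p.2.1 + ![2, 1]))
      = (2 ^ 2 : ℚ)⁻¹ • SchurQ.schurQ (m := 1) xx (2 • l.1 + ![2, 1] + ![1, 0]) := by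
  intro x xx
  refine ⟨(Finset.finite_toSet _).subset (SchurQ.lrCoeff_support_subset l), ?_, ?_⟩
  · rw [SchurQ.finsum_lrCoeff_even, SchurQ.schurQ, SchurQ.pfaffian_one]
    simp [mul_add, xx]
  · rw [SchurQ.finsum_lrCoeff_odd, SchurQ.schurQ, SchurQ.pfaffian_one]
    simp [mul_add, xx, Matrix.vecHead, Matrix.vecTail]
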